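/- **Setting.** For a chain of $N$ qubits labelled $1,\dots,N$ with Pauli operators $X_i,Z_i$, let the generator $K_i$ be $X_i$ times $Z_l$ for each neighbour $l\in\{i-1,i+1\}\cap\{1,\dots,N\}$. Thus $K_i=Z_{i-1}X_iZ_{i+1}$ for $1<i<N$, and for $N\ge 2$ the boundary generators are $K_1=X_1Z_2$ and $K_N=Z_{N-1}X_N$. A state $\rho$ is a density matrix and $\langle K_i\rangle=\mathrm{Tr}[\rho K_i]$. The concurrence of a two-qubit unit vector is $C(\psi)=|\langle\psi|\,\sigma_y\otimes\sigma_y\,|\psi^*\rangle|$. The concurrence of a two-qubit density matrix $\tau$ is $C(\tau)=\inf\sum_i p_iC(\psi_i)$ over all finite decompositions $\tau=\sum_ip_i|\psi_i\rangle\langle\psi_i|$ into pure states. The localizable entanglement of qubits $j\neq l$ in $\rho$ is $$\mathrm{LE}^{j,l}(\rho)=\sup_{m}\sum_s p_s\,C(\rho^{j,l}_{m,s}),$$ where $m$ runs over all choices of one orthonormal measurement basis for each of the other $N-2$ qubits, $s$ over the strings of outcomes, $p_s$ is the probability of $s$, and $\rho^{j,l}_{m,s}$ is the state of qubits $j,l$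 after outcome $s$ (outcomes with $p_s=0$ contribute $0$). **Theorem.** Let $a$ be a real number (the value denoted $\langle ZXZ\rangle$). 1. Let $\rho$ be a state of $N$ qubits with $\langle K_i\rangle\ge a$ for all $1\le i\le N$. Then for all $k\ge1$ and $1\le j<j+k\le N$, $$\mathrm{LE}^{j,j+k}(\rho)\ \ge\ \max\{0,\;1-(k+1)(1-a)\}.$$ 2. The same bound holds if only $\langle Z_{i-1}X_iZ_{i+1}\rangle\ge a$ for all $1<i<N$ is assumed, provided that $k\ge1$ and $1<j<j+k<N$. 3. For a state $\rho_n$ of a segment of $n\ge2$ qubits all of whose $n$ generators $X_1Z_2,\;Z_{i-1}X_iZ_{i+1}\ (1<i<n),\;Z_{n-1}X_n$ have expectation at least $a$ in $\rho_n$, $$\mathrm{LE}^{1,n}(\rho_n)\ \ge\ \max\{0,\;1-n(1-a)\}.$$ 4. In particular, if $a>2/3$, the localizable entanglement across one measured qubit is nonzero: $\mathrm{LE}^{j,j+2}(\rho)>0$ for all $1\le j\le N-2$ under the hypothesis of part 1, $\mathrm{LE}^{j,j+2}(\rho)>0$ for all $1<j<j+2<N$ under the hypothesis of part 2, and $\mathrm{LE}^{1,3}(\rho_3)>0$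 under the hypothesis of part 3 with $n=3$. -/

import Mathlib

open scoped Kronecker Matrix ComplexOrder

namespace LinearCluster

noncomputable section

/-- Computational basis labels of a register of qubits indexed by `ι`; the Hilbert space of the
register is `Reg ι → ℂ` and its operators are matrices indexed by `Reg ι`. -/
abbrev Reg (ι : Type) : Type := ι → Fin 2

/-- Operators on a register of qubits indexed by `ι`. -/
abbrev Op (ι : Type) : Type := Matrix (Reg ι) (Reg ι) ℂ

/-- Operators on a single qubit. -/
abbrev Op1 : Type := Matrix (Fin 2) (Fin 2) ℂ

/-- Operators on an ordered pair of qubits. -/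
abbrev Op2 : Type := Matrix (Fin 2 × Fin 2) (Fin 2 × Fin 2) ℂ

def pauliX : Op1 := !![0, 1; 1, 0]

def pauliY : Op1 := !![0, -Complex.I; Complex.I, 0]

def pauliZ : Op1 := !![1, 0; 0, -1]

/-- A density matrix: positive semidefinite with unit trace. -/
def IsState {d : Type} [Fintype d] (ρ : Matrix d d ℂ) : Prop :=
  ρ.PosSemidef ∧ ρ.trace = 1

/-- Expectation value `Tr[ρ A]` of the observable `A` in the state `ρ` (a real number for
Hermitian `ρ` and `A`, whence the real part). -/
def expVal {d : Type} [Fintype d] (ρ A : Matrix d d ℂ) : ℝ :=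
  (ρ * A).trace.re

/-- The tensor product `⨂ l, A l` of single-qubit operators. -/
def tensorOp {ι : Type} [Fintype ι] (A : ι → Op1) : Op ι :=
  Matrix.of fun x y => ∏ l, A l (x l) (y l)

/-- The generator centred at qubit `i` of a linear chain of `N` qubits (numbered from `0`): `X` on
qubit `i`, `Z` on each neighbour of `i` in the chain, the identity elsewhere. In the bulk this is
`Z_{i-1} X_i Z_{i+1}`; at the ends of a chain of at least two qubits it is `X_0 Z_1` and
`Z_{N-2} X_{N-1}`. -/
def generator {N : ℕ} (i : Fin N) : Op (Fin N) :=
  tensorOp fun l =>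
    if l = i then pauliX
    else if (l : ℕ) + 1 = i ∨ (l : ℕ) = i + 1 then pauliZ
    else 1

/-- Concurrence of the two-qubit state vector `ψ`: the modulus of the overlap of `ψ` with its spin
flip `(Y ⊗ Y) ψ*`. -/
def pureConcurrence (ψ : Fin 2 × Fin 2 → ℂ) : ℝ :=
  ‖star ψ ⬝ᵥ ((pauliY ⊗ₖ pauliY) *ᵥ star ψ)‖

/-- `c` is the average concurrence of some finite decomposition `ρ = ∑ i, p i |ψ i⟩⟨ψ i|` of `ρ`
into pure states. -/
def IsDecompositionAverage (ρ : Op2) (c : ℝ) : Prop :=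
  ∃ (m : ℕ) (p : Fin m → ℝ) (ψ : Fin m → Fin 2 × Fin 2 → ℂ),
    (∀ i, 0 ≤ p i) ∧ ∑ i, p i = 1 ∧
    (∀ i, star (ψ i) ⬝ᵥ ψ i = 1) ∧
    ρ = ∑ i, (p i : ℂ) • Matrix.vecMulVec (ψ i) (star (ψ i)) ∧
    c = ∑ i, p i * pureConcurrence (ψ i)

/-- Concurrence of a two-qubit density matrix: the smallest average concurrence of a decomposition
into pure states (convex roof). -/
def concurrence (ρ : Op2) : ℝ :=
  sInf {c : ℝ | IsDecompositionAverage ρ c}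

/-- The qubits other than the target qubits `i` and `j`. -/
abbrev Others {ι : Type} (i j : ι) : Type := {l : ι // l ≠ i ∧ l ≠ j}

/-- The basis label with value `a` at `i`, `b` at `j` and `z` on the other qubits. -/
def glue {ι : Type} [DecidableEq ι] {i j : ι} (ab : Fin 2 × Fin 2) (z : Reg (Others i j)) :
    Reg ι :=
  fun l => if hi : l = i then ab.1 else if hj : l = j then ab.2 else z ⟨l, hi, hj⟩

/-- Partial trace over all qubits other than `i` and `j`. -/
def reduceTo {ι : Type} [Fintype ι] [DecidableEq ι] (i j : ι) (M : Op ι) : Op2 :=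
  Matrix.of fun ab cd => ∑ z : Reg (Others i j), M (glue ab z) (glue cd z)

/-- A choice of an orthonormal measurement basis for each qubit other than `i`, `j`; the basis
vectors are the columns of the unitary matrix. -/
abbrev MeasurementBases {ι : Type} (i j : ι) : Type :=
  Others i j → Matrix.unitaryGroup (Fin 2) ℂ

/-- The projector onto the basis vector number `s` (column `s` of `U`). -/
def basisProj (U : Matrix.unitaryGroup (Fin 2) ℂ) (s : Fin 2) : Op1 :=
  Matrix.vecMulVec (fun x => U.1 x s) (star fun x => U.1 x s)

/-- The projector for measuring every qubit other than `i`, `j` in the bases `m` with outcomes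
`s`. -/
def outcomeProj {ι : Type} [Fintype ι] [DecidableEq ι] {i j : ι} (m : MeasurementBases i j)
    (s : Reg (Others i j)) : Op ι :=
  tensorOp fun l => if h : l ≠ i ∧ l ≠ j then basisProj (m ⟨l, h⟩) (s ⟨l, h⟩) else 1

/-- The probability `p_s` of the outcomes `s`. -/
def outcomeProb {ι : Type} [Fintype ι] [DecidableEq ι] {i j : ι} (ρ : Op ι)
    (m : MeasurementBases i j) (s : Reg (Others i j)) : ℝ :=
  expVal ρ (outcomeProj m s)

/-- The state of the qubits `i`, `j` after the measurement in the bases `m` with outcomes `s`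
(meaningful when the outcomes have positive probability). -/
def postState {ι : Type} [Fintype ι] [DecidableEq ι] {i j : ι} (ρ : Op ι)
    (m : MeasurementBases i j) (s : Reg (Others i j)) : Op2 :=
  ((outcomeProb ρ m s)⁻¹ : ℂ) • reduceTo i j (outcomeProj m s * ρ * outcomeProj m s)

/-- The average concurrence of the qubits `i`, `j` after measuring the others in the bases `m`.
Outcomes of probability zero contribute zero. -/
def averageConcurrence {ι : Type} [Fintype ι] [DecidableEq ι] {i j : ι} (ρ : Op ι)
    (m : MeasurementBases i j) : ℝ :=
  ∑ s : Reg (Others i j), outcomeProb ρ m s * concurrence (postState ρ m s)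

/-- Localizable entanglement of the qubits `i ≠ j`, measured by concurrence: the supremum of the
average concurrence over all choices of measurement bases on the other qubits. -/
def localizableEntanglement {ι : Type} [Fintype ι] [DecidableEq ι] (ρ : Op ι) (i j : ι) : ℝ :=
  ⨆ m : MeasurementBases i j, averageConcurrence ρ m

end

end LinearCluster

/-!
On a segment from `j` to `l`, multiply the generators centred at the sites of one parity. They
commute, so the union bound `⟨AB⟩ ≥ ⟨A⟩ + ⟨B⟩ - 1` for commuting Hermitian involutions bounds the
expectation of the product from below, and the sites of the two parities together use each
generator of the segment exactly once. Inside the segment neighbouring factors `Z` cancel, and both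
products act there by `X` or the identity, outside by `Z` or the identity. Measuring `X` between
`j` and `l` and `Z` outside therefore turns the two products, for every outcome, into `±A` and `±B`,
where `A`, `B` are `X ⊗ X`, `Z ⊗ Z` or `X ⊗ Z`, `Z ⊗ X` on the qubits `j`, `l`. For each
choice of signs the concurrence is at least `⟨±A⟩ + ⟨±B⟩ - 1`, and this bound is linear in the
state, so it survives the convex roof and the average over outcomes.
-/

namespace LinearCluster

/-! ### Lower bounds on the concurrence -/

lemma re_star_dotProduct_self (ψ : Fin 2 × Fin 2 → ℂ) :
    (star ψ ⬝ᵥ ψ).re = ‖ψ (0, 0)‖ ^ 2 + ‖ψ (0, 1)‖ ^ 2 + ‖ψ (1, 0)‖ ^ 2 + ‖ψ (1, 1)‖ ^ 2 := by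
  simp only [dotProduct, Fintype.sum_prod_type, Fin.sum_univ_two, Pi.star_apply, RCLike.star_def,
    Complex.conj_mul', Complex.add_re, ← Complex.ofReal_pow, Complex.ofReal_re, add_assoc]

lemma pureConcurrence_vec (A : Op1) : pureConcurrence A.vec = 2 * ‖A.det‖ := by
  have h : star A.vec ⬝ᵥ ((pauliY ⊗ₖ pauliY) *ᵥ star A.vec) = star (-2 * A.det) := by
    simp [dotProduct, Matrix.mulVec, Fintype.sum_prod_type, Matrix.kroneckerMap_apply, pauliY,
      Matrix.vec, Matrix.det_fin_two]
    ring_nf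
  rw [pureConcurrence, h, norm_star, norm_mul, norm_neg, Complex.norm_ofNat]

lemma pureConcurrence_eq (ψ : Fin 2 × Fin 2 → ℂ) :
    pureConcurrence ψ = 2 * ‖ψ (0, 0) * ψ (1, 1) - ψ (0, 1) * ψ (1, 0)‖ := by
  obtain ⟨A, rfl⟩ := Matrix.vec_bijective.surjective ψ
  rw [pureConcurrence_vec, Matrix.det_fin_two]
  simp only [Matrix.vec, mul_comm (A 0 1)]

lemma pureConcurrence_kronecker_mulVec (A B : Op1) (ψ : Fin 2 × Fin 2 → ℂ) :
    pureConcurrence ((A ⊗ₖ B) *ᵥ ψ) = ‖A.det‖ * ‖B.det‖ * pureConcurrence ψ := by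
  obtain ⟨C, rfl⟩ := Matrix.vec_bijective.surjective ψ
  rw [Matrix.kronecker_mulVec_vec, pureConcurrence_vec, pureConcurrence_vec, Matrix.det_mul,
    Matrix.det_mul, Matrix.det_transpose, norm_mul, norm_mul]
  ring

lemma pureConcurrence_nonneg (ψ : Fin 2 × Fin 2 → ℂ) : 0 ≤ pureConcurrence ψ := norm_nonneg _

lemma pureConcurrence_le_re_star_dotProduct_self (ψ : Fin 2 × Fin 2 → ℂ) :
    pureConcurrence ψ ≤ (star ψ ⬝ᵥ ψ).re := by
  have h := norm_sub_le (ψ (0, 0) * ψ (1, 1)) (ψ (0, 1) * ψ (1, 0))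
  rw [norm_mul, norm_mul] at h
  rw [pureConcurrence_eq, re_star_dotProduct_self]
  linarith [two_mul_le_add_sq ‖ψ (0, 0)‖ ‖ψ (1, 1)‖, two_mul_le_add_sq ‖ψ (0, 1)‖ ‖ψ (1, 0)‖]

lemma IsDecompositionAverage.nonneg {τ : Op2} {c : ℝ} (h : IsDecompositionAverage τ c) :
    0 ≤ c := by
  obtain ⟨m, p, ψ, hp, -, -, -, rfl⟩ := h
  exact Finset.sum_nonneg fun i _ => mul_nonneg (hp i) (pureConcurrence_nonneg _)

lemma IsDecompositionAverage.le_one {τ : Op2} {c : ℝ} (h : IsDecompositionAverage τ c) :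
    c ≤ 1 := by
  obtain ⟨m, p, ψ, hp, hsum, hψ, -, rfl⟩ := h
  rw [← hsum]
  refine Finset.sum_le_sum fun i _ => mul_le_of_le_one_right (hp i) ?_
  simpa [hψ i] using pureConcurrence_le_re_star_dotProduct_self (ψ i)

lemma concurrence_nonneg (τ : Op2) : 0 ≤ concurrence τ :=
  Real.sInf_nonneg fun _ h => h.nonneg

lemma concurrence_le_one (τ : Op2) : concurrence τ ≤ 1 := by
  rcases Set.eq_empty_or_nonempty {c : ℝ | IsDecompositionAverage τ c} with h | ⟨c, hc⟩
  · simp [concurrence, h]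
  · exact csInf_le_of_le ⟨0, fun _ h => h.nonneg⟩ hc hc.le_one

lemma eq_sum_eigenvalues_smul_vecMulVec {d : Type*} [Fintype d] [DecidableEq d]
    {A : Matrix d d ℂ} (hA : A.IsHermitian) :
    A = ∑ i, (hA.eigenvalues i : ℂ) •
      Matrix.vecMulVec (hA.eigenvectorBasis i) (star (hA.eigenvectorBasis i : d → ℂ)) := by
  conv_lhs => rw [hA.spectral_theorem, Unitary.conjStarAlgAut_apply]
  ext x y
  rw [Matrix.mul_apply, Matrix.sum_apply]
  refine Finset.sum_congr rfl fun i _ => ?_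
  rw [Matrix.mul_diagonal]
  simp only [Matrix.star_apply, Matrix.smul_apply, Matrix.vecMulVec_apply,
    Matrix.IsHermitian.eigenvectorUnitary_apply, Function.comp_apply, Pi.star_apply, smul_eq_mul,
    Complex.coe_algebraMap]
  ring

lemma star_eigenvectorBasis_dotProduct_self {d : Type*} [Fintype d] [DecidableEq d]
    {A : Matrix d d ℂ} (hA : A.IsHermitian) (i : d) :
    star (hA.eigenvectorBasis i : d → ℂ) ⬝ᵥ hA.eigenvectorBasis i = 1 := by
  rw [dotProduct_comm, ← EuclideanSpace.inner_eq_star_dotProduct, hA.eigenvectorBasis.inner_eq_one]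

lemma IsState.exists_isDecompositionAverage {τ : Op2} (hτ : IsState τ) :
    ∃ c, IsDecompositionAverage τ c := by
  have hH := hτ.1.isHermitian
  let e := Fintype.equivFin (Fin 2 × Fin 2)
  refine ⟨_, _, fun i => hH.eigenvalues (e.symm i), fun i => hH.eigenvectorBasis (e.symm i),
    fun i => hτ.1.eigenvalues_nonneg _, ?_,
    fun i => star_eigenvectorBasis_dotProduct_self hH _, ?_, rfl⟩
  · rw [e.symm.sum_comp hH.eigenvalues]
    exact Complex.ofReal_injective (by
      simpa [hτ.2] using hH.trace_eq_sum_eigenvalues.symm)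
  · rw [e.symm.sum_comp fun i => (hH.eigenvalues i : ℂ) •
      Matrix.vecMulVec (hH.eigenvectorBasis i) (star (hH.eigenvectorBasis i : _ → ℂ))]
    exact eq_sum_eigenvalues_smul_vecMulVec hH

/-- An observable whose expectation in every vector is at most the pure-state concurrence. No
normalization is imposed, both sides being quadratic in the vector. -/
def IsConcurrenceWitness (W : Op2) : Prop :=
  ∀ ψ, (star ψ ⬝ᵥ (W *ᵥ ψ)).re ≤ pureConcurrence ψ

lemma IsState.expVal_le_concurrence {τ W : Op2} (hτ : IsState τ) (hW : IsConcurrenceWitness W) :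
    expVal τ W ≤ concurrence τ := by
  refine le_csInf hτ.exists_isDecompositionAverage ?_
  rintro _ ⟨m, p, ψ, hp, -, -, rfl, rfl⟩
  rw [expVal, Finset.sum_mul, Matrix.trace_sum, Complex.re_sum]
  refine Finset.sum_le_sum fun i _ => ?_
  rw [Matrix.smul_mul, Matrix.trace_smul, smul_eq_mul, Complex.re_ofReal_mul,
    Matrix.vecMulVec_mul, Matrix.trace_vecMulVec, dotProduct_comm, ← Matrix.dotProduct_mulVec]
  exact mul_le_mul_of_nonneg_left (hW (ψ i)) (hp i)

lemma expVal_le_trace_mul_concurrence {M W : Op2} (hM : M.PosSemidef)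
    (hW : IsConcurrenceWitness W) :
    expVal M W ≤ M.trace.re * concurrence ((M.trace.re : ℂ)⁻¹ • M) := by
  obtain ⟨hre, him⟩ := Complex.nonneg_iff.1 hM.trace_nonneg
  have htrace : (M.trace.re : ℂ) = M.trace := Complex.ext rfl him
  rcases hre.eq_or_lt with h0 | hpos
  · have : M = 0 := hM.trace_eq_zero_iff.1 (by rw [← htrace, ← h0, Complex.ofReal_zero])
    simp [this, expVal]
  · have hne : (M.trace.re : ℂ) ≠ 0 := Complex.ofReal_ne_zero.2 hpos.ne'
    have hstate : IsState ((M.trace.re : ℂ)⁻¹ • M) := by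
      refine ⟨hM.smul ?_, ?_⟩
      · exact_mod_cast inv_nonneg.2 hre
      · rw [Matrix.trace_smul, smul_eq_mul, ← htrace, Complex.ofReal_re, inv_mul_cancel₀ hne]
    have hscale : expVal M W = M.trace.re * expVal ((M.trace.re : ℂ)⁻¹ • M) W := by
      rw [expVal, expVal, ← Complex.re_ofReal_mul, Matrix.smul_mul, Matrix.trace_smul, smul_eq_mul,
        mul_inv_cancel_left₀ hne]
    rw [hscale]
    exact mul_le_mul_of_nonneg_left (hstate.expVal_le_concurrence hW) hre

lemma IsConcurrenceWitness.conjTranspose_mul_mul {W : Op2} (hW : IsConcurrenceWitness W)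
    {A B : Op1} (hA : ‖A.det‖ = 1) (hB : ‖B.det‖ = 1) :
    IsConcurrenceWitness ((A ⊗ₖ B)ᴴ * W * (A ⊗ₖ B)) := fun ψ => by
  have h := hW ((A ⊗ₖ B) *ᵥ ψ)
  rwa [pureConcurrence_kronecker_mulVec, hA, hB, one_mul, one_mul, Matrix.star_mulVec,
    ← Matrix.dotProduct_mulVec, Matrix.mulVec_mulVec, Matrix.mulVec_mulVec] at h

/-- A pair of two-qubit observables such that `± A ± B - 1` is a concurrence witness for all four
choices of signs. The signs stand for the outcomes of the measurements on the other qubits. -/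
def IsBellPair (A B : Op2) : Prop :=
  ∀ ε δ : ℤˣ, IsConcurrenceWitness (ε • A + δ • B - 1)

lemma IsBellPair.symm {A B : Op2} (h : IsBellPair A B) : IsBellPair B A := fun ε δ => by
  rw [add_comm (ε • B)]
  exact h δ ε

lemma IsBellPair.conj_left {A B C D : Op1} (h : IsBellPair (A ⊗ₖ C) (B ⊗ₖ D))
    (U : Matrix.unitaryGroup (Fin 2) ℂ) :
    IsBellPair ((star (U : Op1) * A * (U : Op1)) ⊗ₖ C)
      ((star (U : Op1) * B * (U : Op1)) ⊗ₖ D) := fun ε δ => by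
  have hU : ‖(U : Op1).det‖ = 1 := CStarRing.norm_of_mem_unitary (Matrix.det_of_mem_unitary U.2)
  have hconj : ∀ E F : Op1, ((U : Op1) ⊗ₖ (1 : Op1))ᴴ * (E ⊗ₖ F) * ((U : Op1) ⊗ₖ (1 : Op1)) =
      (star (U : Op1) * E * (U : Op1)) ⊗ₖ F := fun E F => by
    rw [Matrix.conjTranspose_kronecker, Matrix.conjTranspose_one, ← Matrix.mul_kronecker_mul,
      ← Matrix.mul_kronecker_mul, one_mul, mul_one, Matrix.star_eq_conjTranspose]
  have hone : ((U : Op1) ⊗ₖ (1 : Op1))ᴴ * ((U : Op1) ⊗ₖ (1 : Op1)) = 1 := by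
    simpa using hconj 1 1
  convert (h ε δ).conjTranspose_mul_mul hU (B := 1) (by simp) using 1
  simp only [mul_sub, sub_mul, mul_add, add_mul, mul_one, hone, mul_smul_comm, smul_mul_assoc,
    hconj]

lemma isBellPair_zz_xx : IsBellPair (pauliZ ⊗ₖ pauliZ) (pauliX ⊗ₖ pauliX) := fun ε δ ψ => by
  set a := ψ (0, 0) with ha
  set b := ψ (0, 1) with hb
  set c := ψ (1, 0) with hc
  set d := ψ (1, 1) with hd
  have hre : (star ψ ⬝ᵥ ((ε • (pauliZ ⊗ₖ pauliZ) + δ • (pauliX ⊗ₖ pauliX) - 1) *ᵥ ψ)).re =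
      ((ε : ℤ) : ℝ) * (‖a‖ ^ 2 - ‖b‖ ^ 2 - ‖c‖ ^ 2 + ‖d‖ ^ 2) +
        2 * (((δ : ℤ) : ℝ) * ((star a * d).re + (star b * c).re)) -
        (‖a‖ ^ 2 + ‖b‖ ^ 2 + ‖c‖ ^ 2 + ‖d‖ ^ 2) := by
    rcases Int.units_eq_one_or ε with rfl | rfl <;> rcases Int.units_eq_one_or δ with rfl | rfl <;>
    · simp [dotProduct, Matrix.mulVec, Fintype.sum_prod_type, pauliZ, pauliX, Matrix.one_apply,
        Matrix.kroneckerMap_apply, Complex.sq_norm, Complex.normSq_apply, ← ha, ← hb, ← hc, ← hd]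
      ring
  have hcross : ((δ : ℤ) : ℝ) * ((star a * d).re + (star b * c).re) ≤ ‖a‖ * ‖d‖ + ‖b‖ * ‖c‖ := by
    have had := Complex.abs_re_le_norm (star a * d)
    have hbc := Complex.abs_re_le_norm (star b * c)
    rw [norm_mul, norm_star, abs_le] at had hbc
    rcases Int.units_eq_one_or δ with rfl | rfl <;> push_cast <;> linarith
  have hdet := abs_le.1 (abs_norm_sub_norm_le (a * d) (b * c))
  rw [norm_mul, norm_mul] at hdet
  rw [hre, pureConcurrence_eq]
  rcases Int.units_eq_one_or ε with rfl | rfl <;> push_cast <;>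
    linarith [two_mul_le_add_sq ‖a‖ ‖d‖, two_mul_le_add_sq ‖b‖ ‖c‖]

/-- The Hadamard gate, whose columns are the eigenvectors of `pauliX`: as a measurement basis it
stands for measuring `X`. -/
noncomputable def hadamard : Matrix.unitaryGroup (Fin 2) ℂ :=
  ⟨((√2 : ℝ) : ℂ)⁻¹ • !![1, 1; 1, -1], by
    have h2 : ((√2 : ℝ) : ℂ)⁻¹ * ((√2 : ℝ) : ℂ)⁻¹ = 2⁻¹ := by
      rw [← mul_inv, ← Complex.ofReal_mul, Real.mul_self_sqrt zero_le_two, Complex.ofReal_ofNat]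
    rw [Matrix.mem_unitaryGroup_iff]
    ext x y
    fin_cases x <;> fin_cases y <;>
      simp [Matrix.mul_apply, h2] <;> norm_num⟩

lemma pauliX_mul_hadamard : pauliX * (hadamard : Op1) = (hadamard : Op1) * pauliZ := by
  ext x y
  fin_cases x <;> fin_cases y <;> simp [hadamard, pauliX, pauliZ]

lemma pauliZ_mul_hadamard : pauliZ * (hadamard : Op1) = (hadamard : Op1) * pauliX := by
  ext x y
  fin_cases x <;> fin_cases y <;> simp [hadamard, pauliX, pauliZ]

lemma isBellPair_xz_zx : IsBellPair (pauliX ⊗ₖ pauliZ) (pauliZ ⊗ₖ pauliX) := by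
  have h := isBellPair_zz_xx.conj_left hadamard
  rwa [mul_assoc, mul_assoc, pauliZ_mul_hadamard, pauliX_mul_hadamard, ← mul_assoc, ← mul_assoc,
    Unitary.coe_star_mul_self, one_mul, one_mul] at h

/-! ### Tensor products of single-qubit operators -/

section TensorOp

variable {ι : Type} [Fintype ι]

lemma tensorOp_apply (A : ι → Op1) (x y : Reg ι) : tensorOp A x y = ∏ l, A l (x l) (y l) := rfl

lemma tensorOp_one : tensorOp (1 : ι → Op1) = 1 := by
  ext x y
  simp only [tensorOp_apply, Pi.one_apply, Matrix.one_apply, funext_iff, Finset.prod_ite_zero,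
    Finset.prod_const_one, Finset.mem_univ, true_imp_iff]

lemma tensorOp_mul [DecidableEq ι] (A B : ι → Op1) :
    tensorOp A * tensorOp B = tensorOp (A * B) := by
  ext x y
  simp only [Matrix.mul_apply, tensorOp_apply, ← Finset.prod_mul_distrib, Pi.mul_apply]
  exact (Fintype.prod_sum fun l k => A l (x l) k * B l k (y l)).symm

lemma conjTranspose_tensorOp (A : ι → Op1) : (tensorOp A)ᴴ = tensorOp fun l => (A l)ᴴ := by
  ext x y
  simp only [Matrix.conjTranspose_apply, tensorOp_apply, star_prod]

lemma tensorOp_units_smul (ε : ι → ℤˣ) (A : ι → Op1) :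
    (tensorOp fun l => ε l • A l) = (∏ l, ε l) • tensorOp A := by
  ext x y
  simp only [Matrix.smul_apply, tensorOp_apply]
  simp only [Units.smul_def, zsmul_eq_mul, Finset.prod_mul_distrib, Units.coe_prod, Int.cast_prod]

lemma sum_tensorOp [DecidableEq ι] (A : ι → Fin 2 → Op1) :
    ∑ s : Reg ι, tensorOp (fun l => A l (s l)) = tensorOp fun l => ∑ k, A l k := by
  ext x y
  simp only [Matrix.sum_apply, tensorOp_apply, Fintype.prod_sum]

end TensorOp

/-! ### Splitting off two qubits -/

section Split

variable {ι : Type} [DecidableEq ι] {i j : ι}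

/-- Basis labels of a register as pairs of a label of the qubits `i`, `j` and a label of the
others. -/
def glueEquiv (hij : i ≠ j) : (Fin 2 × Fin 2) × Reg (Others i j) ≃ Reg ι where
  toFun q := glue q.1 q.2
  invFun x := ((x i, x j), fun l => x l)
  left_inv q := by
    refine Prod.ext (Prod.ext ?_ ?_) (funext fun l => ?_)
    · simp [glue]
    · simp [glue, hij.symm]
    · simp [glue, l.2.1, l.2.2]
  right_inv x := by
    funext l
    grind [glue]

variable [Fintype ι]

/-- The identification of the operators on a register with the operators on the tensor product of
the qubits `i`, `j` with the other qubits. -/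
noncomputable def joinOp (hij : i ≠ j) :
    Matrix ((Fin 2 × Fin 2) × Reg (Others i j)) ((Fin 2 × Fin 2) × Reg (Others i j)) ℂ ≃ₐ[ℂ]
      Op ι :=
  Matrix.reindexAlgEquiv ℂ ℂ (glueEquiv hij)

lemma trace_joinOp (hij : i ≠ j)
    (M : Matrix ((Fin 2 × Fin 2) × Reg (Others i j)) ((Fin 2 × Fin 2) × Reg (Others i j)) ℂ) :
    (joinOp hij M).trace = M.trace :=
  (glueEquiv hij).symm.sum_comp fun q => M q q

lemma prod_eq_mul_mul_prod_others {M : Type*} [CommMonoid M] (hij : i ≠ j) (f : ι → M) :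
    ∏ l, f l = f i * f j * ∏ l : Others i j, f l := by
  rw [← Finset.mul_prod_erase _ _ (Finset.mem_univ i),
    ← Finset.mul_prod_erase _ _ (Finset.mem_erase.2 ⟨hij.symm, Finset.mem_univ j⟩), mul_assoc]
  congr 2
  refine Finset.prod_subtype _ (fun l => ?_) f
  simp [and_comm]

lemma joinOp_kronecker_tensorOp (hij : i ≠ j) (F : ι → Op1) :
    joinOp hij ((F i ⊗ₖ F j) ⊗ₖ tensorOp fun l : Others i j => F l) = tensorOp F := by
  ext x y
  rw [tensorOp_apply, prod_eq_mul_mul_prod_others hij]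
  rfl

lemma trace_reduceTo_mul (hij : i ≠ j) (M : Op ι) (A : Op2) :
    (reduceTo i j M * A).trace =
      (M * joinOp hij (A ⊗ₖ (1 : Op (Others i j)))).trace := by
  obtain ⟨M, rfl⟩ := (joinOp hij).surjective M
  have hreduce : ∀ ab cd, reduceTo i j (joinOp hij M) ab cd = ∑ z, M (ab, z) (cd, z) :=
    fun ab cd => Finset.sum_congr rfl fun z _ => congrArg₂ M
      ((glueEquiv hij).symm_apply_apply (ab, z)) ((glueEquiv hij).symm_apply_apply (cd, z))
  rw [← map_mul, trace_joinOp]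
  simp only [Matrix.trace, Matrix.diag, Matrix.mul_apply, hreduce,
    Fintype.sum_prod_type (α₁ := Fin 2 × Fin 2), Matrix.kroneckerMap_apply, Matrix.one_apply,
    mul_ite, mul_one, mul_zero, Finset.sum_ite_eq', Finset.mem_univ, if_true, Finset.sum_mul]
  exact Finset.sum_congr rfl fun ab _ => Finset.sum_comm

lemma kronecker_sum {l m n p κ : Type*} (A : Matrix l m ℂ) (s : Finset κ)
    (B : κ → Matrix n p ℂ) :
    A ⊗ₖ ∑ k ∈ s, B k = ∑ k ∈ s, A ⊗ₖ B k :=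
  map_sum (Matrix.kroneckerBilinear (R := ℂ) A) B s

lemma posSemidef_reduceTo (i j : ι) {M : Op ι} (hM : M.PosSemidef) :
    (reduceTo i j M).PosSemidef := by
  have h : reduceTo i j M = ∑ z : Reg (Others i j), M.submatrix (glue · z) (glue · z) := by
    ext ab cd
    simp only [reduceTo, Matrix.of_apply, Matrix.sum_apply, Matrix.submatrix_apply]
  rw [h]
  exact Matrix.posSemidef_sum _ fun z _ => hM.submatrix _

end Split

/-! ### Expectation values -/

section ExpVal

variable {d : Type} [Fintype d] (ρ : Matrix d d ℂ)

lemma expVal_add (A B : Matrix d d ℂ) : expVal ρ (A + B) = expVal ρ A + expVal ρ B := by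
  rw [expVal, mul_add, Matrix.trace_add, Complex.add_re, expVal, expVal]

lemma expVal_sub (A B : Matrix d d ℂ) : expVal ρ (A - B) = expVal ρ A - expVal ρ B := by
  rw [expVal, mul_sub, Matrix.trace_sub, Complex.sub_re, expVal, expVal]

lemma expVal_sum {κ : Type*} (s : Finset κ) (A : κ → Matrix d d ℂ) :
    expVal ρ (∑ k ∈ s, A k) = ∑ k ∈ s, expVal ρ (A k) := by
  simp only [expVal, Finset.mul_sum, Matrix.trace_sum, Complex.re_sum]

lemma expVal_smul (A : Matrix d d ℂ) (c : ℝ) : expVal ρ (c • A) = c * expVal ρ A := by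
  rw [expVal, Matrix.mul_smul, Matrix.trace_smul, Complex.smul_re, smul_eq_mul, expVal]

lemma expVal_one [DecidableEq d] : expVal ρ 1 = ρ.trace.re := by
  rw [expVal, mul_one]

end ExpVal

/-! ### Local projective measurements -/

lemma basisProj_isHermitian (U : Matrix.unitaryGroup (Fin 2) ℂ) (s : Fin 2) :
    (basisProj U s).IsHermitian := by
  ext x y
  simp [basisProj, Matrix.vecMulVec_apply, mul_comm]

lemma basisProj_mul_self (U : Matrix.unitaryGroup (Fin 2) ℂ) (s : Fin 2) :
    basisProj U s * basisProj U s = basisProj U s := by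
  have h : star (fun x => U.1 x s) ⬝ᵥ (fun x => U.1 x s) = 1 := by
    have := congrFun (congrFun (Matrix.mem_unitaryGroup_iff'.1 U.2) s) s
    simpa [Matrix.mul_apply, dotProduct, Matrix.star_apply] using this
  rw [basisProj, Matrix.vecMulVec_mul_vecMulVec, h, one_smul]

lemma sum_basisProj (U : Matrix.unitaryGroup (Fin 2) ℂ) : ∑ s, basisProj U s = 1 := by
  rw [← Matrix.mem_unitaryGroup_iff.1 U.2]
  ext x y
  simp [basisProj, Matrix.vecMulVec_apply, Matrix.mul_apply, Matrix.sum_apply]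

section Measurement

variable {ι : Type} [Fintype ι] [DecidableEq ι] {i j : ι}

lemma outcomeProj_eq_joinOp (hij : i ≠ j) (m : MeasurementBases i j) (s : Reg (Others i j)) :
    outcomeProj m s = joinOp hij (1 ⊗ₖ tensorOp fun l => basisProj (m l) (s l)) := by
  rw [outcomeProj, ← joinOp_kronecker_tensorOp hij]
  simp only [ne_eq, not_true_eq_false, false_and, and_false, dite_false, Matrix.one_kronecker_one]
  congr 3
  exact funext fun l => dif_pos l.2

lemma outcomeProj_isHermitian (m : MeasurementBases i j) (s : Reg (Others i j)) :
    (outcomeProj m s).IsHermitian := by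
  rw [Matrix.IsHermitian, outcomeProj, conjTranspose_tensorOp]
  congr 1
  funext l
  split_ifs
  · exact basisProj_isHermitian _ _
  · exact Matrix.isHermitian_one

/-- The state of the qubits `i`, `j` after the outcomes `s`, weighted by the probability of `s`. -/
noncomputable def unnormalizedPostState (ρ : Op ι) (m : MeasurementBases i j)
    (s : Reg (Others i j)) : Op2 :=
  reduceTo i j (outcomeProj m s * ρ * outcomeProj m s)

lemma posSemidef_unnormalizedPostState {ρ : Op ι} (hρ : ρ.PosSemidef) (m : MeasurementBases i j)
    (s : Reg (Others i j)) : (unnormalizedPostState ρ m s).PosSemidef := by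
  have h := hρ.mul_mul_conjTranspose_same (outcomeProj m s)
  rw [(outcomeProj_isHermitian m s).eq] at h
  exact posSemidef_reduceTo i j h

lemma expVal_unnormalizedPostState (hij : i ≠ j) (ρ : Op ι) (m : MeasurementBases i j)
    (s : Reg (Others i j)) (A : Op2) :
    expVal (unnormalizedPostState ρ m s) A =
      expVal ρ (joinOp hij (A ⊗ₖ tensorOp fun l => basisProj (m l) (s l))) := by
  have hproj : (outcomeProj m s) * joinOp hij (A ⊗ₖ (1 : Op (Others i j))) * outcomeProj m s =
      joinOp hij (A ⊗ₖ tensorOp fun l => basisProj (m l) (s l)) := by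
    rw [outcomeProj_eq_joinOp hij, ← map_mul, ← map_mul, ← Matrix.mul_kronecker_mul,
      ← Matrix.mul_kronecker_mul, one_mul, mul_one, mul_one, tensorOp_mul]
    congr 3
    exact funext fun l => basisProj_mul_self _ _
  rw [expVal, expVal, unnormalizedPostState, trace_reduceTo_mul hij, ← hproj, mul_assoc, mul_assoc,
    Matrix.trace_mul_comm, mul_assoc, mul_assoc]

lemma outcomeProb_eq_trace (hij : i ≠ j) (ρ : Op ι) (m : MeasurementBases i j)
    (s : Reg (Others i j)) : outcomeProb ρ m s = (unnormalizedPostState ρ m s).trace.re := by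
  rw [← expVal_one, expVal_unnormalizedPostState hij, ← outcomeProj_eq_joinOp, outcomeProb]

lemma outcomeProb_nonneg (hij : i ≠ j) {ρ : Op ι} (hρ : ρ.PosSemidef) (m : MeasurementBases i j)
    (s : Reg (Others i j)) : 0 ≤ outcomeProb ρ m s := by
  rw [outcomeProb_eq_trace hij]
  exact (Complex.nonneg_iff.1 (posSemidef_unnormalizedPostState hρ m s).trace_nonneg).1

lemma expVal_unnormalizedPostState_le (hij : i ≠ j) {ρ : Op ι} (hρ : ρ.PosSemidef)
    (m : MeasurementBases i j) (s : Reg (Others i j)) {W : Op2} (hW : IsConcurrenceWitness W) :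
    expVal (unnormalizedPostState ρ m s) W ≤
      outcomeProb ρ m s * concurrence (postState ρ m s) := by
  rw [postState, outcomeProb_eq_trace hij]
  exact expVal_le_trace_mul_concurrence (posSemidef_unnormalizedPostState hρ m s) hW

lemma sum_expVal_unnormalizedPostState (hij : i ≠ j) (ρ : Op ι) (m : MeasurementBases i j)
    (A : Op2) : ∑ s, expVal (unnormalizedPostState ρ m s) A =
      expVal ρ (joinOp hij (A ⊗ₖ (1 : Op (Others i j)))) := by
  have hsum : ∑ s : Reg (Others i j), (tensorOp fun l => basisProj (m l) (s l)) = 1 := by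
    rw [sum_tensorOp fun l k => basisProj (m l) k]
    simp only [sum_basisProj]
    exact tensorOp_one
  simp only [expVal_unnormalizedPostState hij, ← expVal_sum, ← map_sum]
  rw [← hsum, kronecker_sum]

lemma sum_outcomeProb (hij : i ≠ j) {ρ : Op ι} (hρ : IsState ρ) (m : MeasurementBases i j) :
    ∑ s, outcomeProb ρ m s = 1 := by
  simp only [outcomeProb_eq_trace hij, ← expVal_one]
  rw [sum_expVal_unnormalizedPostState hij, Matrix.one_kronecker_one, map_one, expVal_one, hρ.2,
    Complex.one_re]

lemma averageConcurrence_nonneg (hij : i ≠ j) {ρ : Op ι} (hρ : ρ.PosSemidef)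
    (m : MeasurementBases i j) : 0 ≤ averageConcurrence ρ m :=
  Finset.sum_nonneg fun s _ => mul_nonneg (outcomeProb_nonneg hij hρ m s) (concurrence_nonneg _)

lemma averageConcurrence_le_one (hij : i ≠ j) {ρ : Op ι} (hρ : IsState ρ)
    (m : MeasurementBases i j) : averageConcurrence ρ m ≤ 1 := by
  rw [← sum_outcomeProb hij hρ m]
  exact Finset.sum_le_sum fun s _ =>
    mul_le_of_le_one_right (outcomeProb_nonneg hij hρ.1 m s) (concurrence_le_one _)

lemma averageConcurrence_le_localizableEntanglement (hij : i ≠ j) {ρ : Op ι} (hρ : IsState ρ)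
    (m : MeasurementBases i j) : averageConcurrence ρ m ≤ localizableEntanglement ρ i j :=
  le_ciSup (f := averageConcurrence ρ)
    ⟨1, Set.forall_mem_range.2 (averageConcurrence_le_one hij hρ)⟩ m

lemma localizableEntanglement_nonneg (hij : i ≠ j) {ρ : Op ι} (hρ : ρ.PosSemidef) :
    0 ≤ localizableEntanglement ρ i j :=
  Real.iSup_nonneg (averageConcurrence_nonneg hij hρ)

end Measurement

/-! ### Observables acting by signs on the measured bases -/

/-- The vectors of the basis `U` are eigenvectors of `F` with eigenvalues `1` or `-1`, so that a
measurement in the basis `U` replaces `F` by a sign. -/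
def IsSignDiagonal (F : Op1) (U : Matrix.unitaryGroup (Fin 2) ℂ) : Prop :=
  ∃ ε : Fin 2 → ℤˣ, ∀ s, F * basisProj U s = ε s • basisProj U s

lemma isSignDiagonal_one (U : Matrix.unitaryGroup (Fin 2) ℂ) : IsSignDiagonal 1 U :=
  ⟨1, fun s => by rw [one_mul, Pi.one_apply, one_smul]⟩

lemma IsSignDiagonal.pow {F : Op1} {U : Matrix.unitaryGroup (Fin 2) ℂ} (h : IsSignDiagonal F U)
    (n : ℕ) : IsSignDiagonal (F ^ n) U := by
  obtain ⟨ε, hε⟩ := h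
  refine ⟨ε ^ n, fun s => ?_⟩
  induction n with
  | zero => rw [pow_zero, pow_zero, Pi.one_apply, one_smul, one_mul]
  | succ n ih => rw [pow_succ, mul_assoc, hε, mul_smul_comm, ih, smul_smul, pow_succ', Pi.mul_apply]

lemma isSignDiagonal_pauliZ : IsSignDiagonal pauliZ 1 :=
  ⟨![1, -1], fun s => by
    ext x y
    fin_cases s <;> fin_cases x <;> fin_cases y <;>
      simp [basisProj, pauliZ, Matrix.mul_apply, Matrix.vecMulVec_apply]⟩

lemma isSignDiagonal_pauliX : IsSignDiagonal pauliX hadamard :=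
  ⟨![1, -1], fun s => by
    rw [basisProj, Matrix.mul_vecMulVec, Units.smul_def, ← Matrix.smul_vecMulVec]
    congr 1
    ext x
    fin_cases s <;> fin_cases x <;> simp [pauliX, hadamard, Matrix.mulVec]⟩

section BellPair

variable {ι : Type} [Fintype ι] [DecidableEq ι] {i j : ι}

lemma exists_expVal_tensorOp_eq_sum (hij : i ≠ j) (ρ : Op ι) {m : MeasurementBases i j}
    {F : ι → Op1} (hF : ∀ l : Others i j, IsSignDiagonal (F l) (m l)) :
    ∃ ε : Reg (Others i j) → ℤˣ, expVal ρ (tensorOp F) =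
      ∑ s, expVal (unnormalizedPostState ρ m s) (ε s • (F i ⊗ₖ F j)) := by
  choose ε hε using hF
  refine ⟨fun s => ∏ l, ε l (s l), ?_⟩
  have hsplit : (tensorOp fun l : Others i j => F l) =
      ∑ s : Reg (Others i j), (∏ l, ε l (s l)) • tensorOp fun l => basisProj (m l) (s l) := by
    simp only [← tensorOp_units_smul, ← hε]
    rw [sum_tensorOp fun (l : Others i j) k => F l * basisProj (m l) k]
    simp only [← Finset.mul_sum, sum_basisProj, mul_one]
  simp only [expVal_unnormalizedPostState hij, ← expVal_sum, ← map_sum]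
  rw [← joinOp_kronecker_tensorOp hij, hsplit, kronecker_sum]
  simp only [Matrix.smul_kronecker, Matrix.kronecker_smul]

lemma expVal_add_expVal_sub_one_le_averageConcurrence (hij : i ≠ j) {ρ : Op ι} (hρ : IsState ρ)
    {m : MeasurementBases i j} {F G : ι → Op1}
    (hF : ∀ l : Others i j, IsSignDiagonal (F l) (m l))
    (hG : ∀ l : Others i j, IsSignDiagonal (G l) (m l))
    (hFG : IsBellPair (F i ⊗ₖ F j) (G i ⊗ₖ G j)) :
    expVal ρ (tensorOp F) + expVal ρ (tensorOp G) - 1 ≤ averageConcurrence ρ m := by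
  obtain ⟨ε, hε⟩ := exists_expVal_tensorOp_eq_sum hij ρ hF
  obtain ⟨δ, hδ⟩ := exists_expVal_tensorOp_eq_sum hij ρ hG
  rw [hε, hδ, ← sum_outcomeProb hij hρ m, ← Finset.sum_add_distrib, ← Finset.sum_sub_distrib]
  refine Finset.sum_le_sum fun s _ => ?_
  have h := expVal_unnormalizedPostState_le hij hρ.1 m s (hFG (ε s) (δ s))
  rwa [expVal_sub, expVal_add, expVal_one, ← outcomeProb_eq_trace hij] at h

end BellPair

/-! ### Products of stabilizer generators -/

section Stabilizer

variable {d : Type} [Fintype d]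

lemma expVal_conjTranspose_mul_self_nonneg {ρ : Matrix d d ℂ} (hρ : ρ.PosSemidef)
    (A : Matrix d d ℂ) : 0 ≤ expVal ρ (Aᴴ * A) := by
  rw [expVal, ← mul_assoc, Matrix.trace_mul_comm, ← mul_assoc]
  exact (Complex.nonneg_iff.1 (hρ.mul_mul_conjTranspose_same A).trace_nonneg).1

lemma expVal_add_expVal_sub_trace_le_expVal_mul [DecidableEq d] {ρ A B : Matrix d d ℂ}
    (hρ : ρ.PosSemidef) (hA : A.IsHermitian) (hB : B.IsHermitian) (hAB : Commute A B)
    (hA1 : A * A = 1) (hB1 : B * B = 1) :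
    expVal ρ A + expVal ρ B - ρ.trace.re ≤ expVal ρ (A * B) := by
  have hcomm : Commute (1 - A) (1 - B) :=
    (Commute.one_left _).sub_left ((Commute.one_right A).sub_right hAB)
  have hsq : ∀ C : Matrix d d ℂ, C * C = 1 → (1 - C) * (1 - C) = (2 : ℝ) • (1 - C) := by
    intro C hC
    rw [mul_sub, mul_one, sub_mul, one_mul, hC, two_smul]
    abel
  -- `(1 - A) * (1 - B)` is four times a projection.
  have hproj : ((1 - A) * (1 - B))ᴴ * ((1 - A) * (1 - B)) = (4 : ℝ) • ((1 - A) * (1 - B)) := by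
    rw [Matrix.conjTranspose_mul, Matrix.conjTranspose_sub, Matrix.conjTranspose_sub,
      Matrix.conjTranspose_one, hA.eq, hB.eq, ← hcomm.eq, hcomm.symm.mul_mul_mul_comm, hsq A hA1,
      hsq B hB1, smul_mul_smul_comm]
    norm_num
  have hnonneg := expVal_conjTranspose_mul_self_nonneg hρ ((1 - A) * (1 - B))
  have hexpand : (1 - A) * (1 - B) = 1 - A - B + A * B := by noncomm_ring
  rw [hproj, expVal_smul, hexpand, expVal_add, expVal_sub, expVal_sub, expVal_one] at hnonneg
  linarith

lemma pauliX_isHermitian : pauliX.IsHermitian := by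
  ext x y
  fin_cases x <;> fin_cases y <;> simp [pauliX]

lemma pauliZ_isHermitian : pauliZ.IsHermitian := by
  ext x y
  fin_cases x <;> fin_cases y <;> simp [pauliZ]

lemma pauliX_mul_self : pauliX * pauliX = 1 := by
  ext x y
  fin_cases x <;> fin_cases y <;> simp [pauliX]

lemma pauliZ_mul_self : pauliZ * pauliZ = 1 := by
  ext x y
  fin_cases x <;> fin_cases y <;> simp [pauliZ]

end Stabilizer

section GraphString

variable {V : Type} (G : SimpleGraph V)

open Classical in
/-- The tensor factors of the product of the graph-state generators `X_e ∏_{l ∼ e} Z_l` centred at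
the vertices `e` of `E`. The formula is valid when `E` is independent; otherwise a vertex of `E`
would also receive factors `pauliZ`. -/
noncomputable def graphString (E : Finset V) (l : V) : Op1 :=
  if l ∈ E then pauliX else pauliZ ^ (E.filter (G.Adj l)).card

lemma graphString_empty : graphString G ∅ = 1 := by
  ext1 l
  simp [graphString]

lemma graphString_isHermitian (E : Finset V) (l : V) : (graphString G E l).IsHermitian := by
  unfold graphString
  split_ifs
  · exact pauliX_isHermitian
  · exact pauliZ_isHermitian.pow _

lemma graphString_mul_self (E : Finset V) : graphString G E * graphString G E = 1 := by
  ext1 l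
  unfold graphString
  simp only [Pi.mul_apply, Pi.one_apply]
  split_ifs
  · exact pauliX_mul_self
  · rw [← (Commute.refl pauliZ).mul_pow, pauliZ_mul_self, one_pow]

variable {G}

lemma graphString_insert [DecidableEq V] {E : Finset V} {i : V} (hi : i ∉ E)
    (hE : ∀ e ∈ E, ¬ G.Adj i e) :
    graphString G (insert i E) = graphString G E * graphString G {i} := by
  classical
  ext1 l
  simp only [graphString, Pi.mul_apply, Finset.mem_insert, Finset.mem_singleton,
    Finset.filter_insert, Finset.filter_singleton]
  by_cases hli : l = i
  · subst hli
    simp [hi, Finset.filter_eq_empty_iff.2 fun e he => hE e he]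
  by_cases hlE : l ∈ E
  · have : ¬ G.Adj l i := fun h => hE l hlE h.symm
    simp [hli, hlE, this]
  by_cases hadj : G.Adj l i <;> simp [hli, hlE, hadj, hi, pow_succ]

variable [Fintype V]

lemma tensorOp_graphString_isHermitian (E : Finset V) :
    (tensorOp (graphString G E)).IsHermitian := by
  rw [Matrix.IsHermitian, conjTranspose_tensorOp]
  exact congrArg _ (funext (graphString_isHermitian G E))

lemma one_sub_sum_le_expVal_graphString [DecidableEq V] {ρ : Op V} (hρ : IsState ρ)
    {E : Finset V} (hE : G.IsIndepSet E) :
    1 - ∑ i ∈ E, (1 - expVal ρ (tensorOp (graphString G {i}))) ≤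
      expVal ρ (tensorOp (graphString G E)) := by
  have hinv : ∀ E, tensorOp (graphString G E) * tensorOp (graphString G E) = 1 := fun E => by
    rw [tensorOp_mul, graphString_mul_self, tensorOp_one]
  induction E using Finset.induction_on with
  | empty => simp [graphString_empty, tensorOp_one, expVal_one, hρ.2]
  | insert i E hi ih =>
    rw [Finset.coe_insert] at hE
    have hmul : tensorOp (graphString G (insert i E)) =
        tensorOp (graphString G E) * tensorOp (graphString G {i}) := by
      rw [tensorOp_mul, graphString_insert hi fun e he =>
        hE (Set.mem_insert i _) (Set.mem_insert_of_mem i he) (ne_of_mem_of_not_mem he hi).symm]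
    have hcomm : Commute (tensorOp (graphString G E)) (tensorOp (graphString G {i})) := by
      rw [(tensorOp_graphString_isHermitian E).commute_iff (tensorOp_graphString_isHermitian {i}),
        ← hmul]
      exact tensorOp_graphString_isHermitian _
    have hstep := expVal_add_expVal_sub_trace_le_expVal_mul hρ.1
      (tensorOp_graphString_isHermitian E) (tensorOp_graphString_isHermitian {i}) hcomm
      (hinv E) (hinv {i})
    rw [← hmul, hρ.2, Complex.one_re] at hstep
    rw [Finset.sum_insert hi]
    linarith [ih (hE.mono (Set.subset_insert i _))]

end GraphString

/-! ### Segments of the chain -/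

section Chain

variable {N : ℕ}

lemma generator_eq_tensorOp_graphString (i : Fin N) :
    generator i = tensorOp (graphString (SimpleGraph.pathGraph N) {i}) := by
  rw [generator]
  congr 1
  ext1 l
  simp only [graphString, Finset.mem_singleton, Finset.filter_singleton,
    SimpleGraph.pathGraph_adj, eq_comm (a := (i : ℕ) + 1)]
  split_ifs <;> simp

/-- The sites of the segment from `j` to `l` with the parity of `r`. -/
def paritySites (j l : Fin N) (r : ℕ) : Finset (Fin N) :=
  {i ∈ Finset.Icc j l | (i : ℕ) % 2 = r % 2}

lemma mem_paritySites {j l q : Fin N} {r : ℕ} :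
    q ∈ paritySites j l r ↔ ((j : ℕ) ≤ q ∧ (q : ℕ) ≤ l) ∧ (q : ℕ) % 2 = r % 2 := by
  rw [paritySites, Finset.mem_filter, Finset.mem_Icc, Fin.le_def, Fin.le_def]

lemma sum_paritySites_add_sum_paritySites_succ {M : Type*} [AddCommMonoid M] (j l : Fin N)
    (r : ℕ) (f : Fin N → M) :
    ∑ i ∈ paritySites j l r, f i + ∑ i ∈ paritySites j l (r + 1), f i =
      ∑ i ∈ Finset.Icc j l, f i := by
  have hnot : paritySites j l (r + 1) =
      {i ∈ Finset.Icc j l | ¬ ((i : Fin N) : ℕ) % 2 = r % 2} :=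
    Finset.filter_congr fun i _ => by omega
  rw [hnot, paritySites, Finset.sum_filter_add_sum_filter_not]

lemma isIndepSet_paritySites (j l : Fin N) (r : ℕ) :
    (SimpleGraph.pathGraph N).IsIndepSet (paritySites j l r) := fun p hp q hq _ => by
  rw [Finset.mem_coe, mem_paritySites] at hp hq
  rw [SimpleGraph.pathGraph_adj]
  omega

/-- The tensor factors of the product of the generators centred at `paritySites j l r`. -/
noncomputable abbrev parityString (j l : Fin N) (r : ℕ) : Fin N → Op1 :=
  graphString (SimpleGraph.pathGraph N) (paritySites j l r)

lemma parityString_eq_pauliX {j l q : Fin N} {r : ℕ} (hjq : j ≤ q) (hql : q ≤ l)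
    (hr : (q : ℕ) % 2 = r % 2) : parityString j l r q = pauliX :=
  if_pos (mem_paritySites.2 ⟨⟨hjq, hql⟩, hr⟩)

lemma parityString_eq_pow {j l q : Fin N} {r : ℕ} (hr : (q : ℕ) % 2 ≠ r % 2) {s : Finset (Fin N)}
    (hs : ∀ e : Fin N, e ∈ s ↔ ((j : ℕ) ≤ e ∧ (e : ℕ) ≤ l) ∧
      ((q : ℕ) + 1 = e ∨ (e : ℕ) + 1 = q)) :
    parityString j l r q = pauliZ ^ s.card := by
  classical
  rw [parityString, graphString, if_neg fun h => hr (mem_paritySites.1 h).2]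
  congr 2
  ext e
  rw [Finset.mem_filter, mem_paritySites, SimpleGraph.pathGraph_adj, hs]
  omega

lemma parityString_eq_one {j l q : Fin N} {r : ℕ} (hjq : j < q) (hql : q < l)
    (hr : (q : ℕ) % 2 ≠ r % 2) : parityString j l r q = 1 := by
  rw [Fin.lt_def] at hjq hql
  have hne : (⟨q - 1, by omega⟩ : Fin N) ≠ ⟨q + 1, by omega⟩ := by
    rw [Ne, Fin.mk.injEq]
    omega
  rw [parityString_eq_pow hr (s := {⟨q - 1, by omega⟩, ⟨q + 1, by omega⟩}), Finset.card_pair hne,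
    sq, pauliZ_mul_self]
  intro e
  simp only [Finset.mem_insert, Finset.mem_singleton, Fin.ext_iff]
  omega

lemma parityString_left {j l : Fin N} {r : ℕ} (hjl : j < l) (hr : (j : ℕ) % 2 ≠ r % 2) :
    parityString j l r j = pauliZ := by
  rw [Fin.lt_def] at hjl
  rw [parityString_eq_pow hr (s := {⟨j + 1, by omega⟩}), Finset.card_singleton, pow_one]
  intro e
  simp only [Finset.mem_singleton, Fin.ext_iff]
  omega

lemma parityString_right {j l : Fin N} {r : ℕ} (hjl : j < l) (hr : (l : ℕ) % 2 ≠ r % 2) :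
    parityString j l r l = pauliZ := by
  rw [Fin.lt_def] at hjl
  rw [parityString_eq_pow hr (s := {⟨l - 1, by omega⟩}), Finset.card_singleton, pow_one]
  intro e
  simp only [Finset.mem_singleton, Fin.ext_iff]
  omega

/-- The measurement of `X` on the qubits between `j` and `l` and of `Z` on those outside the
segment. -/
noncomputable def segmentBases (j l : Fin N) : MeasurementBases j l := fun q =>
  if j < q ∧ q < l then hadamard else 1

lemma isSignDiagonal_parityString {j l : Fin N} (r : ℕ) (q : Others j l) :
    IsSignDiagonal (parityString j l r q) (segmentBases j l q) := by
  rw [segmentBases]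
  split_ifs with hq
  · by_cases hr : (q : ℕ) % 2 = r % 2
    · rw [parityString_eq_pauliX hq.1.le hq.2.le hr]
      exact isSignDiagonal_pauliX
    · rw [parityString_eq_one hq.1 hq.2 hr]
      exact isSignDiagonal_one _
  · have hmem : (q : Fin N) ∉ paritySites j l r := fun h => by
      have h := (mem_paritySites.1 h).1
      exact hq ⟨lt_of_le_of_ne h.1 q.2.1.symm, lt_of_le_of_ne h.2 q.2.2⟩
    rw [parityString, graphString, if_neg hmem]
    exact isSignDiagonal_pauliZ.pow _

lemma isBellPair_parityString {j l : Fin N} (hjl : j < l) :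
    IsBellPair (parityString j l j j ⊗ₖ parityString j l j l)
      (parityString j l (j + 1) j ⊗ₖ parityString j l (j + 1) l) := by
  rw [parityString_eq_pauliX le_rfl hjl.le rfl, parityString_left hjl (r := j + 1) (by omega)]
  by_cases hl : (l : ℕ) % 2 = j % 2
  · rw [parityString_eq_pauliX hjl.le le_rfl hl, parityString_right hjl (by omega)]
    exact isBellPair_zz_xx.symm
  · rw [parityString_right hjl hl, parityString_eq_pauliX hjl.le le_rfl (by omega)]
    exact isBellPair_xz_zx

lemma max_zero_one_sub_sum_le_localizableEntanglement {ρ : Op (Fin N)} (hρ : IsState ρ)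
    {j l : Fin N} (hjl : j < l) :
    max 0 (1 - ∑ i ∈ Finset.Icc j l, (1 - expVal ρ (generator i))) ≤
      localizableEntanglement ρ j l := by
  refine max_le (localizableEntanglement_nonneg hjl.ne hρ.1) ?_
  have hbound : ∀ r : ℕ, 1 - ∑ i ∈ paritySites j l r, (1 - expVal ρ (generator i)) ≤
      expVal ρ (tensorOp (parityString j l r)) := fun r => by
    simp only [generator_eq_tensorOp_graphString]
    exact one_sub_sum_le_expVal_graphString hρ (isIndepSet_paritySites j l r)
  have hmeasure := expVal_add_expVal_sub_one_le_averageConcurrence hjl.ne hρ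
    (isSignDiagonal_parityString j) (isSignDiagonal_parityString (j + 1))
    (isBellPair_parityString hjl)
  have hle := averageConcurrence_le_localizableEntanglement hjl.ne hρ (segmentBases j l)
  rw [← sum_paritySites_add_sum_paritySites_succ j l j]
  linarith [hbound j, hbound (j + 1)]

lemma le_localizableEntanglement_of_le_expVal {ρ : Op (Fin N)} (hρ : IsState ρ)
    {j l : Fin N} {k : ℕ} {a : ℝ} (hk : 1 ≤ k) (hl : (l : ℕ) = j + k)
    (hK : ∀ i : Fin N, j ≤ i → i ≤ l → a ≤ expVal ρ (generator i)) :
    max 0 (1 - ((k : ℝ) + 1) * (1 - a)) ≤ localizableEntanglement ρ j l := by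
  have hjl : j < l := by
    rw [Fin.lt_def]
    omega
  refine le_trans ?_ (max_zero_one_sub_sum_le_localizableEntanglement hρ hjl)
  have hsum := Finset.sum_le_card_nsmul (Finset.Icc j l) (fun i => 1 - expVal ρ (generator i))
    (1 - a) fun i hi => sub_le_sub_left (hK i (Finset.mem_Icc.1 hi).1 (Finset.mem_Icc.1 hi).2) 1
  rw [Fin.card_Icc, hl, add_assoc, Nat.add_sub_cancel_left, nsmul_eq_mul, Nat.cast_succ] at hsum
  gcongr

lemma localizableEntanglement_pos_of_le_expVal {ρ : Op (Fin N)} (hρ : IsState ρ) {j l : Fin N}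
    {a : ℝ} (ha : 2 / 3 < a) (hl : (l : ℕ) = j + 2)
    (hK : ∀ i : Fin N, j ≤ i → i ≤ l → a ≤ expVal ρ (generator i)) :
    0 < localizableEntanglement ρ j l := by
  have h := (le_max_right _ _).trans (le_localizableEntanglement_of_le_expVal hρ one_le_two hl hK)
  push_cast at h
  linarith

end Chain

end LinearCluster

theorem mainTheorem1 (a : ℝ) :
    -- Chain with all its generators, including those at the two ends: any pair of qubits.
    (∀ (N : ℕ) (ρ : LinearCluster.Op (Fin N)), LinearCluster.IsState ρ →
      (∀ i : Fin N, a ≤ LinearCluster.expVal ρ (LinearCluster.generator i)) →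
      ∀ (j l : Fin N) (k : ℕ), 1 ≤ k → (l : ℕ) = j + k →
        max 0 (1 - ((k : ℝ) + 1) * (1 - a)) ≤ LinearCluster.localizableEntanglement ρ j l) ∧
    -- Chain with generators on three neighbouring qubits only: any pair of qubits in the bulk.
    (∀ (N : ℕ) (ρ : LinearCluster.Op (Fin N)), LinearCluster.IsState ρ →
      (∀ i : Fin N, 0 < (i : ℕ) → (i : ℕ) + 1 < N →
        a ≤ LinearCluster.expVal ρ (LinearCluster.generator i)) →
      ∀ (j l : Fin N) (k : ℕ), 1 ≤ k → (l : ℕ) = j + k → 0 < (j : ℕ) → (l : ℕ) + 1 < N →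
        max 0 (1 - ((k : ℝ) + 1) * (1 - a)) ≤ LinearCluster.localizableEntanglement ρ j l) ∧
    -- The end qubits of a segment of `n` qubits with boundary generators `XZ` and `ZX`.
    (∀ (n : ℕ) (hn : 2 ≤ n) (ρ : LinearCluster.Op (Fin n)), LinearCluster.IsState ρ →
      (∀ i : Fin n, a ≤ LinearCluster.expVal ρ (LinearCluster.generator i)) →
        max 0 (1 - (n : ℝ) * (1 - a)) ≤
          LinearCluster.localizableEntanglement ρ ⟨0, by omega⟩ ⟨n - 1, by omega⟩) ∧
    -- The threshold `2/3` for entanglement across one qubit, in the same three situations.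
    (2 / 3 < a →
      (∀ (N : ℕ) (ρ : LinearCluster.Op (Fin N)), LinearCluster.IsState ρ →
        (∀ i : Fin N, a ≤ LinearCluster.expVal ρ (LinearCluster.generator i)) →
        ∀ j l : Fin N, (l : ℕ) = j + 2 →
          0 < LinearCluster.localizableEntanglement ρ j l) ∧
      (∀ (N : ℕ) (ρ : LinearCluster.Op (Fin N)), LinearCluster.IsState ρ →
        (∀ i : Fin N, 0 < (i : ℕ) → (i : ℕ) + 1 < N →
          a ≤ LinearCluster.expVal ρ (LinearCluster.generator i)) →
        ∀ j l : Fin N, (l : ℕ) = j + 2 → 0 < (j : ℕ) → (l : ℕ) + 1 < N →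
          0 < LinearCluster.localizableEntanglement ρ j l) ∧
      (∀ ρ : LinearCluster.Op (Fin 3), LinearCluster.IsState ρ →
        (∀ i : Fin 3, a ≤ LinearCluster.expVal ρ (LinearCluster.generator i)) →
          0 < LinearCluster.localizableEntanglement ρ 0 2)) := by
  have bulk : ∀ {N : ℕ} {j l : Fin N} {P : Fin N → Prop}, 0 < (j : ℕ) → (l : ℕ) + 1 < N →
      (∀ i : Fin N, 0 < (i : ℕ) → (i : ℕ) + 1 < N → P i) → ∀ i, j ≤ i → i ≤ l → P i :=
    fun hj hl hP i hji hil => hP i (hj.trans_le hji) ((Nat.succ_le_succ hil).trans_lt hl)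
  refine ⟨fun N ρ hρ hK j l k hk hl =>
      LinearCluster.le_localizableEntanglement_of_le_expVal hρ hk hl fun i _ _ => hK i,
    fun N ρ hρ hK j l k hk hl hj hlN =>
      LinearCluster.le_localizableEntanglement_of_le_expVal hρ hk hl (bulk hj hlN hK),
    fun n hn ρ hρ hK => ?_,
    fun ha => ⟨fun N ρ hρ hK j l hl =>
        LinearCluster.localizableEntanglement_pos_of_le_expVal hρ ha hl fun i _ _ => hK i,
      fun N ρ hρ hK j l hl hj hlN =>
        LinearCluster.localizableEntanglement_pos_of_le_expVal hρ ha hl (bulk hj hlN hK),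
      fun ρ hρ hK =>
        LinearCluster.localizableEntanglement_pos_of_le_expVal hρ ha rfl fun i _ _ => hK i⟩⟩
  have h := LinearCluster.le_localizableEntanglement_of_le_expVal hρ (j := ⟨0, by omega⟩)
    (l := ⟨n - 1, by omega⟩) (k := n - 1) (by omega) (by simp) fun i _ _ => hK i
  rwa [Nat.cast_pred (by omega), sub_add_cancel] at h
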